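/- Let $Q$ be a simple polygon in the plane with vertex set $P$ (at least three vertices; three vertices may be collinear), regarded as a closed region. Represent $Q$ as a relational structure on the ground set $P$ with a ternary relation, the order type $\Omega(P)=\{(a,b,c)\in P^3 : abc \text{ is a counter-clockwise oriented triangle}\}$, and a binary relation, the edge relation of the counter-clockwise directed Hamiltonian cycle of the boundary edges of $Q$. The visibility graph of $Q$ has vertex set $P$, and distinct $x,y\in P$ are adjacent if and only if the straight line segment $\overline{xy}$ is disjoint from the complement of $Q$. Then the visibility graph of $Q$ has an MSO interpretation in $Q$: there is a single monadic second-order formula $\varepsilon(x,y)$ over these two relation symbols, not depending on $Q$, such that for every simple polygon $Q$ and all $x,y\in P$, $\{x,y\}$ is an edge of the visibility graph of $Q$ if and only if $Q\models\varepsilon(x,y)$. Moreover, distinct $x,y\in P$ are adjacent in the visibility graph if and only if (i) at every vertex $v\in P$ on the segment $\overline{xy}$ (these are only the two ends $x$ and $y$ if no three vertices are collinear), the segment lies in the polygon's closed interior angle at $v$, i.e. those of $x,y$ that differ from $v$ lie in directions from $v$ within that angle, and (ii) no edge of $Q$ strictly crosses $\overline{xy}$, i.e. crosses it transversally in a point interior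 to both. -/

import Mathlib

/-! ### Monadic second-order logic over relational signatures -/

/-- Formulas of monadic second-order (MSO) logic over the relation symbols of the signature `L`,
with `n` free element variables and `k` free set variables. The only terms are element variables.
In the scope of an element (set) quantifier, the element (set) variable `0` is the quantified one
and the variable `i + 1` is the variable `i` outside of the scope. -/
inductive MSOFormula (L : FirstOrder.Language.{0, 0}) : ℕ → ℕ → Type
  | falsum {n k : ℕ} : MSOFormula L n k
  | equal {n k : ℕ} (i j : Fin n) : MSOFormula L n k
  | rel {n k a : ℕ} (R : L.Relations a) (v : Fin a → Fin n) : MSOFormula L n k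
  | mem {n k : ℕ} (i : Fin n) (X : Fin k) : MSOFormula L n k
  | not {n k : ℕ} (φ : MSOFormula L n k) : MSOFormula L n k
  | and {n k : ℕ} (φ ψ : MSOFormula L n k) : MSOFormula L n k
  | or {n k : ℕ} (φ ψ : MSOFormula L n k) : MSOFormula L n k
  | existsElem {n k : ℕ} (φ : MSOFormula L (n + 1) k) : MSOFormula L n k
  | forallElem {n k : ℕ} (φ : MSOFormula L (n + 1) k) : MSOFormula L n k
  | existsSet {n k : ℕ} (φ : MSOFormula L n (k + 1)) : MSOFormula L n k
  | forallSet {n k : ℕ} (φ : MSOFormula L n (k + 1)) : MSOFormula L n k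

/-- Satisfaction `S ⊨ φ(x; X)` of an MSO formula in the `L`-structure `S` on the ground set `U`. -/
def MSOFormula.Realize {L : FirstOrder.Language.{0, 0}} {U : Type} (S : L.Structure U) :
    {n k : ℕ} → MSOFormula L n k → (Fin n → U) → (Fin k → Set U) → Prop
  | _, _, .falsum, _, _ => False
  | _, _, .equal i j, x, _ => x i = x j
  | _, _, .rel R v, x, _ => S.RelMap R (fun s => x (v s))
  | _, _, .mem i Y, x, X => x i ∈ X Y
  | _, _, .not φ, x, X => ¬ φ.Realize S x X
  | _, _, .and φ ψ, x, X => φ.Realize S x X ∧ ψ.Realize S x X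
  | _, _, .or φ ψ, x, X => φ.Realize S x X ∨ ψ.Realize S x X
  | _, _, .existsElem φ, x, X => ∃ a : U, φ.Realize S (Matrix.vecCons a x) X
  | _, _, .forallElem φ, x, X => ∀ a : U, φ.Realize S (Matrix.vecCons a x) X
  | _, _, .existsSet φ, x, X => ∃ A : Set U, φ.Realize S x (Matrix.vecCons A X)
  | _, _, .forallSet φ, x, X => ∀ A : Set U, φ.Realize S x (Matrix.vecCons A X)

/-- A (simple) MSO interpretation of `τ`-structures in `σ`-structures, for relational signatures
`σ` and `τ`: for every symbol of `τ` an MSO formula of signature `σ` with as many free (element)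
variables as the arity of the symbol, and without free set variables. -/
structure MSOInterpretation (σ τ : FirstOrder.Language.{0, 0})
    [σ.IsRelational] [τ.IsRelational] where
  formula : {a : ℕ} → τ.Relations a → MSOFormula σ a 0

/-- The `τ`-structure `T` is interpreted via `Ψ` in the `σ`-structure `S` on the same
ground set. -/
def MSOInterpretation.Interprets {σ τ : FirstOrder.Language.{0, 0}}
    [σ.IsRelational] [τ.IsRelational] (Ψ : MSOInterpretation σ τ) {U : Type}
    (S : σ.Structure U) (T : τ.Structure U) : Prop :=
  ∀ (a : ℕ) (R : τ.Relations a) (x : Fin a → U),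
    T.RelMap R x ↔ (Ψ.formula R).Realize S x ![]

/-! ### Simple polygons in the plane -/

/-- The Euclidean plane. -/
abbrev EPlane : Type := EuclideanSpace ℝ (Fin 2)

/-- Twice the signed area of the triangle `abc`: positive iff `abc` is a counter-clockwise
triangle, negative iff it is a clockwise one, zero iff `a, b, c` are collinear. -/
def orient (a b c : EPlane) : ℝ :=
  (b 0 - a 0) * (c 1 - a 1) - (b 1 - a 1) * (c 0 - a 0)

namespace Polygon

variable {n : ℕ}

/-- A simple polygon: at least three vertices, all distinct, and two different edges
have no point in common except a common end vertex. -/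
def IsSimple (Q : Polygon EPlane n) : Prop :=
  3 ≤ n ∧ Function.Injective Q.vertices ∧
    ∀ i j : Fin n, i ≠ j →
      Q.edgeSet ℝ i ∩ Q.edgeSet ℝ j ⊆
        {Q i, Q (finRotate n i)} ∩ {Q j, Q (finRotate n j)}

/-- The closed region of the plane enclosed by the polygon: its boundary together with all
points that lie in a bounded connected component of the complement of the boundary. -/
def region (Q : Polygon EPlane n) : Set EPlane :=
  Q.boundary ℝ ∪
    {p | p ∉ Q.boundary ℝ ∧ Bornology.IsBounded (connectedComponentIn (Q.boundary ℝ)ᶜ p)}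

/-- The vertices are listed in counter-clockwise order along the boundary: near every inner point
of every edge, the points to the left of the edge belong to the polygon. -/
def IsCounterclockwise (Q : Polygon EPlane n) : Prop :=
  ∀ i : Fin n, ∀ p ∈ openSegment ℝ (Q i) (Q (finRotate n i)),
    ∀ᶠ q in nhds p, 0 < orient (Q i) (Q (finRotate n i)) q → q ∈ Q.region

/-- The vertex set of the polygon. -/
abbrev vertexSet (Q : Polygon EPlane n) : Set EPlane := Set.range Q.vertices

/-- The visibility graph: two distinct vertices are adjacent iff the line segment between them
is disjoint from the complement of the polygon. -/
def visibilityGraph (Q : Polygon EPlane n) : SimpleGraph Q.vertexSet where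
  Adj x y := x ≠ y ∧ Disjoint (segment ℝ (x : EPlane) (y : EPlane)) (Q.region)ᶜ
  symm := ⟨fun x y h => ⟨h.1.symm, by rw [segment_symm]; exact h.2⟩⟩
  loopless := ⟨fun _ h => h.1 rfl⟩

/-- The direction from the vertex `Q i` to the point `p` lies in the closed interior angle at
`Q i` of a counter-clockwise polygon. This angle is bounded by the incoming edge `a → Q i` and the
outgoing edge `Q i → b`. If it is at most `π`, it is the intersection of the closed half-planes to
the left of these two edges, and otherwise it is their union. At `p = Q i` this holds. -/
def InAngle (Q : Polygon EPlane n) (i : Fin n) (p : EPlane) : Prop :=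
  let a := Q ((finRotate n).symm i)
  let v := Q i
  let b := Q (finRotate n i)
  if 0 ≤ orient a v b then 0 ≤ orient a v p ∧ 0 ≤ orient v b p
  else 0 ≤ orient a v p ∨ 0 ≤ orient v b p

end Polygon

/-- The segments `xy` and `zw` cross each other in a point interior to both: `x, y` lie strictly
on different sides of the line `zw`, and `z, w` lie strictly on different sides of the
line `xy`. -/
def SegmentsCross (x y z w : EPlane) : Prop :=
  orient x z w * orient y z w < 0 ∧ orient z x y * orient w x y < 0

/-! ### The relational structure of a polygon -/

/-- The relation symbols: ternary for the order type, binary for the directed boundary cycle. -/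
inductive PolygonRel : ℕ → Type
  | ordccw : PolygonRel 3
  | poledge : PolygonRel 2

/-- The relational signature of polygons. -/
def polygonSignature : FirstOrder.Language.{0, 0} := ⟨fun _ => Empty, PolygonRel⟩

instance polygonSignature_isRelational : polygonSignature.IsRelational :=
  fun _ => inferInstanceAs (IsEmpty Empty)

/-- The polygon as a relational structure on its vertex set: the order type of the vertex set
and the Hamiltonian cycle of the directed boundary edges. -/
abbrev Polygon.toStructure {n : ℕ} (Q : Polygon EPlane n) :
    polygonSignature.Structure Q.vertexSet where
  funMap f := nomatch f
  RelMap R := match R with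
    | .ordccw => fun x => 0 < orient (x 0) (x 1) (x 2)
    | .poledge => fun x => ∃ i : Fin n, (x 0 : EPlane) = Q i ∧ (x 1 : EPlane) = Q (finRotate n i)

open AffineMap Set

/-! The heart of the matter is that the region is known locally: near an inner point of an edge it
is the closed left half-plane (`eventually_mem_region_iff_orient`), and near a vertex it is the
closed interior angle (`eventually_mem_region_iff_inAngle`). Counter-clockwise order puts the left
sides inside; what has to be shown is that the right sides are outside. This needs no Jordan curve
theorem. The region is neither empty nor the whole plane, so it has a frontier point, which must lie
on the boundary, and outside points accumulate there. They can only lie to the right of an edge or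
in the exterior angle of a vertex. A thin strip along the right side of an edge, and the exterior
angle close to a vertex, are connected and avoid the boundary, so each is entirely inside or
entirely outside. Being outside therefore spreads along an edge, then through a vertex to the next
edge, and so around the whole cycle (`rightOutside_all`).

Given this, a segment inside the region leaves each vertex on it into the angle there, and cannot
pass to the right side of an edge. Conversely, from a point of the segment off the boundary, walk
along the segment to the first boundary point `q`. The path without `q` avoids the boundary, so it
suffices to find points of it close to `q` in the region. If `q` is a vertex, the angle condition
provides them; otherwise the absence of a crossing puts the segment on the line of the edge through
`q` (`segment_subset_region`).

Both conditions depend only on signs of orientations and on the edge relation. Betweenness on a line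
is read off from a vertex not on that line, which exists because a simple polygon is not contained
in a line (`exists_orient_ne_zero`, `mem_segment_iff`). The resulting formula quantifies over
elements only. -/

/-! ### Orientation, lines and segments -/

theorem orient_lineMap (a b p q : EPlane) (t : ℝ) :
    orient a b (lineMap p q t) = (1 - t) * orient a b p + t * orient a b q := by
  simp only [orient, lineMap_apply_module, PiLp.add_apply, PiLp.smul_apply, smul_eq_mul]
  ring

theorem orient_rotate (a b c : EPlane) : orient b c a = orient a b c := by
  simp only [orient]; ring

theorem orient_swap_left (a b c : EPlane) : orient b a c = -orient a b c := by
  simp only [orient]; ring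

theorem orient_swap_right (a b c : EPlane) : orient a c b = -orient a b c := by
  simp only [orient]; ring

@[simp] theorem orient_self_right (a b : EPlane) : orient a b b = 0 := by
  simp only [orient]; ring

@[simp] theorem orient_self_outer (a b : EPlane) : orient a b a = 0 := by
  simp only [orient]; ring

theorem continuous_orient (a b : EPlane) : Continuous (orient a b) := by
  unfold orient; fun_prop

theorem convex_orient_pos (a b : EPlane) : Convex ℝ {q | 0 < orient a b q} := by
  intro p hp q hq s t hs ht hst
  have h : orient a b (s • p + t • q) = s * orient a b p + t * orient a b q := by
    obtain rfl : s = 1 - t := by linarith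
    rw [← orient_lineMap, lineMap_apply_module]
  simp only [mem_ofPred_eq] at *
  rw [h]
  rcases hs.eq_or_lt with rfl | hs
  · have : t = 1 := by linarith
    simpa [this] using hq
  · nlinarith [mul_pos hs hp, mul_nonneg ht hq.le]

theorem convex_orient_neg (a b : EPlane) : Convex ℝ {q | orient a b q < 0} := by
  have h : {q | orient a b q < 0} = {q | 0 < orient b a q} := by
    ext q; simp [orient_swap_left a b]
  rw [h]; exact convex_orient_pos b a

/-- A point of the line through two distinct points is an affine combination of them. -/
theorem exists_eq_lineMap_of_orient_eq_zero {a b p : EPlane} (hab : a ≠ b)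
    (h : orient a b p = 0) : ∃ t : ℝ, p = lineMap a b t := by
  simp only [orient] at h
  by_cases h0 : b 0 - a 0 = 0
  · have h1 : b 1 - a 1 ≠ 0 := by
      intro h1
      apply hab
      ext i
      fin_cases i
      · change a 0 = b 0; linarith
      · change a 1 = b 1; linarith
    refine ⟨(p 1 - a 1) / (b 1 - a 1), ?_⟩
    have hp : p 0 - a 0 = 0 := by
      rw [h0] at h
      have : (b 1 - a 1) * (p 0 - a 0) = 0 := by linarith
      exact (mul_eq_zero.mp this).resolve_left h1
    ext i
    fin_cases i
    · simp [lineMap_apply_module]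
      linear_combination hp - ((p 1 - a 1) / (b 1 - a 1)) * h0
    · simp [lineMap_apply_module]
      field_simp; ring
  · refine ⟨(p 0 - a 0) / (b 0 - a 0), ?_⟩
    ext i
    fin_cases i
    · simp [lineMap_apply_module]
      field_simp; ring
    · simp [lineMap_apply_module]
      field_simp
      linear_combination h

theorem isCompact_segment (x y : EPlane) : IsCompact (segment ℝ x y) := by
  rw [segment_eq_image_lineMap]
  exact isCompact_Icc.image lineMap_continuous

theorem lineMap_mem_segment_of_le {p q : EPlane} {t : ℝ} (h0 : 0 ≤ t) (h1 : t ≤ 1) :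
    lineMap p q t ∈ segment ℝ p q := by
  rw [segment_eq_image_lineMap]
  exact ⟨t, ⟨h0, h1⟩, rfl⟩

theorem orient_eq_zero_of_mem_segment {a b p : EPlane} (h : p ∈ segment ℝ a b) :
    orient a b p = 0 := by
  rw [segment_eq_image_lineMap] at h
  obtain ⟨t, -, rfl⟩ := h
  simp [orient_lineMap]

/-- A point on a ray, closer to its origin than some point of the ray, lies on the segment. -/
theorem lineMap_mem_segment_of_dist_lt {p q : EPlane} {t : ℝ} (h0 : 0 ≤ t)
    (hd : dist (lineMap p q t) p < dist p q) : lineMap p q t ∈ segment ℝ p q := by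
  rw [dist_lineMap_left, Real.norm_eq_abs, abs_of_nonneg h0] at hd
  have : 0 < dist p q := by nlinarith [dist_nonneg (x := p) (y := q)]
  exact lineMap_mem_segment_of_le h0 (by by_contra! h; nlinarith)

/-- Every neighbourhood of `p` contains points `lineMap p q s` with `0 < s < 1`. -/
theorem exists_lineMap_of_eventually {p : EPlane} (q : EPlane) {P : EPlane → Prop}
    (h : ∀ᶠ z in nhds p, P z) : ∃ s : ℝ, 0 < s ∧ s < 1 ∧ P (lineMap p q s) := by
  have hc : Filter.Tendsto (fun s : ℝ => (lineMap p q s : EPlane)) (nhds 0) (nhds p) := by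
    simpa using (lineMap_continuous (R := ℝ) (p := p) (q := q)).tendsto (0 : ℝ)
  have h1 : ∀ᶠ s in nhdsWithin (0 : ℝ) (Ioi 0), P (lineMap p q s) :=
    (hc.eventually h).filter_mono nhdsWithin_le_nhds
  have h2 : ∀ᶠ s in nhdsWithin (0 : ℝ) (Ioi 0), s ∈ Ioo (0 : ℝ) 1 :=
    Ioo_mem_nhdsGT one_pos
  obtain ⟨s, hs, hs'⟩ := (h1.and h2).exists
  exact ⟨s, hs'.1, hs'.2, hs⟩

/-- There is a point strictly to the left of a nondegenerate directed line. -/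
theorem exists_orient_pos {a b : EPlane} (hab : a ≠ b) : ∃ q, 0 < orient a b q := by
  -- The witness is `a` plus the vector `b - a` turned left by a right angle.
  refine ⟨!₂[a 0 - (b 1 - a 1), a 1 + (b 0 - a 0)], ?_⟩
  have : b 0 - a 0 ≠ 0 ∨ b 1 - a 1 ≠ 0 := by
    by_contra! h
    apply hab
    ext i
    fin_cases i
    · change a 0 = b 0; linarith [h.1]
    · change a 1 = b 1; linarith [h.2]
  simp [orient]
  rcases this with h | h
  · nlinarith [sq_nonneg (b 1 - a 1), sq_pos_of_ne_zero h]
  · nlinarith [sq_nonneg (b 0 - a 0), sq_pos_of_ne_zero h]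

/-- Every neighbourhood of a point of a line contains points strictly to the left of the line. -/
theorem exists_orient_pos_of_eventually {a b p : EPlane} (hab : a ≠ b) (hp : orient a b p = 0)
    {P : EPlane → Prop} (h : ∀ᶠ z in nhds p, P z) : ∃ q, 0 < orient a b q ∧ P q := by
  obtain ⟨q, hq⟩ := exists_orient_pos hab
  obtain ⟨s, hs0, -, hs⟩ := exists_lineMap_of_eventually q h
  refine ⟨_, ?_, hs⟩
  rw [orient_lineMap, hp]
  nlinarith [mul_pos hs0 hq]

theorem exists_orient_neg_of_eventually {a b p : EPlane} (hab : a ≠ b) (hp : orient a b p = 0)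
    {P : EPlane → Prop} (h : ∀ᶠ z in nhds p, P z) : ∃ q, orient a b q < 0 ∧ P q := by
  obtain ⟨q, hq, hP⟩ := exists_orient_pos_of_eventually hab.symm
    (by rw [orient_swap_left, hp, neg_zero]) h
  exact ⟨q, by rw [orient_swap_left] at hq; linarith, hP⟩

/-! ### Angles at the end of two segments -/

/-- The closed angle to the left of the path `a → v → b`. -/
def ClosedAngle (a v b p : EPlane) : Prop :=
  if 0 ≤ orient a v b then 0 ≤ orient a v p ∧ 0 ≤ orient v b p
  else 0 ≤ orient a v p ∨ 0 ≤ orient v b p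

/-- The open angle to the left of the path `a → v → b`. -/
def OpenAngle (a v b p : EPlane) : Prop :=
  if 0 ≤ orient a v b then 0 < orient a v p ∧ 0 < orient v b p
  else 0 < orient a v p ∨ 0 < orient v b p

/-- The path `a → v → b` is nondegenerate and does not turn back at `v`. -/
structure IsBend (a v b : EPlane) : Prop where
  ne_left : v ≠ a
  ne_right : v ≠ b
  straight : orient a v b = 0 → ∃ c : ℝ, 0 < c ∧ b = lineMap v a (-c)

/-- At a straight angle both sides lie on one directed line, so the two half-planes that define the
angle coincide. -/
theorem IsBend.orient_straight {a v b : EPlane} (h : IsBend a v b) (h0 : orient a v b = 0) :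
    ∃ c : ℝ, 0 < c ∧ ∀ q, orient v b q = c * orient a v q := by
  obtain ⟨c, hc, rfl⟩ := h.straight h0
  refine ⟨c, hc, fun q => ?_⟩
  rw [orient_rotate q v, orient_lineMap]
  simp only [orient]
  ring

/-- The angle is a cone with apex `v`; this carries information close to `v` to the far ends of a
segment and back. -/
theorem ClosedAngle.lineMap_iff {a v b p : EPlane} {s : ℝ} (hs : 0 < s) :
    ClosedAngle a v b (lineMap v p s) ↔ ClosedAngle a v b p := by
  unfold ClosedAngle
  simp [orient_lineMap, hs]

theorem orient_lineMap_outgoing (a v b : EPlane) (s : ℝ) :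
    orient a v (lineMap v b s) = s * orient a v b := by
  simp [orient_lineMap]

theorem orient_lineMap_incoming (a v b : EPlane) (s : ℝ) :
    orient v b (lineMap v a s) = s * orient a v b := by
  simp [orient_lineMap, orient_rotate a v b]

theorem closedAngle_and_not_openAngle_of_mem_segment_right {a v b q : EPlane}
    (hq : q ∈ segment ℝ v b) : ClosedAngle a v b q ∧ ¬ OpenAngle a v b q := by
  have h1 := orient_eq_zero_of_mem_segment hq
  rw [segment_eq_image_lineMap] at hq
  obtain ⟨s, ⟨hs, -⟩, rfl⟩ := hq
  have h2 := orient_lineMap_outgoing a v b s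
  unfold ClosedAngle OpenAngle
  rw [h1, h2]
  split_ifs with h0
  · simp [mul_nonneg hs h0]
  · have := mul_nonneg hs (neg_nonneg.mpr (not_le.mp h0).le)
    simp; nlinarith

theorem closedAngle_and_not_openAngle_of_mem_segment_left {a v b q : EPlane}
    (hq : q ∈ segment ℝ a v) : ClosedAngle a v b q ∧ ¬ OpenAngle a v b q := by
  have h1 := orient_eq_zero_of_mem_segment hq
  rw [segment_symm, segment_eq_image_lineMap] at hq
  obtain ⟨s, ⟨hs, -⟩, rfl⟩ := hq
  have h2 := orient_lineMap_incoming a v b s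
  unfold ClosedAngle OpenAngle
  rw [h1, h2]
  split_ifs with h0
  · simp [mul_nonneg hs h0]
  · have := mul_nonneg hs (neg_nonneg.mpr (not_le.mp h0).le)
    simp; nlinarith

/-- Near the apex, a point of the closed but not of the open angle is on one of the two sides. -/
theorem IsBend.mem_segment {a v b q : EPlane} (h : IsBend a v b)
    (hc : ClosedAngle a v b q) (ho : ¬ OpenAngle a v b q)
    (ha : dist q v < dist v a) (hb : dist q v < dist v b) :
    q ∈ segment ℝ a v ∨ q ∈ segment ℝ v b := by
  have left : ∀ s : ℝ, q = lineMap v a s → 0 ≤ s → q ∈ segment ℝ a v ∨ q ∈ segment ℝ v b := by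
    rintro s rfl hs
    left; rw [segment_symm]; exact lineMap_mem_segment_of_dist_lt hs ha
  have right : ∀ s : ℝ, q = lineMap v b s → 0 ≤ s → q ∈ segment ℝ a v ∨ q ∈ segment ℝ v b := by
    rintro s rfl hs
    right; exact lineMap_mem_segment_of_dist_lt hs hb
  have hl : orient a v q = 0 → ∃ s : ℝ, q = lineMap v a s := fun h0 =>
    exists_eq_lineMap_of_orient_eq_zero h.ne_left (by rw [orient_swap_left, h0, neg_zero])
  have hr : orient v b q = 0 → ∃ s : ℝ, q = lineMap v b s :=
    exists_eq_lineMap_of_orient_eq_zero h.ne_right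
  unfold ClosedAngle at hc
  unfold OpenAngle at ho
  rcases lt_trichotomy (orient a v b) 0 with h0 | h0 | h0
  · rw [if_neg h0.not_ge] at hc ho
    push Not at ho
    rcases hc with hc | hc
    · obtain ⟨s, hs⟩ := hl (le_antisymm ho.1 hc)
      refine left s hs ?_
      have := ho.2
      rw [hs, orient_lineMap_incoming] at this
      by_contra! hs0; nlinarith [mul_pos_of_neg_of_neg hs0 h0]
    · obtain ⟨s, hs⟩ := hr (le_antisymm ho.2 hc)
      refine right s hs ?_
      have := ho.1
      rw [hs, orient_lineMap_outgoing] at this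
      by_contra! hs0; nlinarith [mul_pos_of_neg_of_neg hs0 h0]
  · rw [if_pos h0.ge] at hc ho
    obtain ⟨k, hk, hkq⟩ := h.orient_straight h0
    have hz : orient a v q = 0 := by
      by_contra hne
      have : 0 < orient a v q := lt_of_le_of_ne hc.1 (Ne.symm hne)
      exact ho ⟨this, by rw [hkq]; positivity⟩
    obtain ⟨s, hs⟩ := hl hz
    rcases le_or_gt 0 s with hs0 | hs0
    · exact left s hs hs0
    · obtain ⟨c, hc, hb'⟩ := h.straight h0
      -- Here `q = v + s (a - v)` and `b = v - c (a - v)`, so `q` has parameter `-s / c` on the ray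
      -- from `v` to `b`.
      refine right (-s / c) ?_ (by have := neg_pos.mpr hs0; positivity)
      rw [hs, hb', lineMap_apply_module, lineMap_apply_module, lineMap_apply_module]
      match_scalars <;> field_simp; ring
  · rw [if_pos h0.le] at hc ho
    rcases hc.1.eq_or_lt with h1 | h1
    · obtain ⟨s, hs⟩ := hl h1.symm
      refine left s hs ?_
      have := hc.2
      rw [hs, orient_lineMap_incoming] at this
      by_contra! hs0; nlinarith [mul_neg_of_neg_of_pos hs0 h0]
    · have h2 : orient v b q = 0 := by
        by_contra hne
        exact ho ⟨h1, lt_of_le_of_ne hc.2 (Ne.symm hne)⟩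
      obtain ⟨s, hs⟩ := hr h2
      refine right s hs ?_
      have := hc.1
      rw [hs, orient_lineMap_outgoing] at this
      by_contra! hs0; nlinarith [mul_neg_of_neg_of_pos hs0 h0]

/-- The part of the union of two open half-planes near a common boundary point of them. -/
theorem isPreconnected_orient_pos_or {a v b : EPlane} (h : IsBend a v b)
    (h0 : orient a v b ≤ 0) (ε : ℝ) :
    IsPreconnected (Metric.ball v ε ∩ {q | 0 < orient a v q ∨ 0 < orient v b q}) := by
  have hu : Metric.ball v ε ∩ {q | 0 < orient a v q ∨ 0 < orient v b q} =
      (Metric.ball v ε ∩ {q | 0 < orient a v q}) ∪ (Metric.ball v ε ∩ {q | 0 < orient v b q}) := by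
    rw [← inter_union_distrib_left]; rfl
  have c1 : IsPreconnected (Metric.ball v ε ∩ {q | 0 < orient a v q}) :=
    ((convex_ball v ε).inter (convex_orient_pos a v)).isPreconnected
  have c2 : IsPreconnected (Metric.ball v ε ∩ {q | 0 < orient v b q}) :=
    ((convex_ball v ε).inter (convex_orient_pos v b)).isPreconnected
  rcases le_or_gt ε 0 with hε | hε
  · rw [Metric.ball_eq_empty.mpr hε, empty_inter]; exact isPreconnected_empty
  rcases h0.lt_or_eq with h0 | h0
  -- The direction `(v - a) - (b - v)` points strictly into both half-planes of a reflex angle, so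
  -- the two convex pieces overlap.
  · obtain ⟨s, hs0, -, hs⟩ := exists_lineMap_of_eventually (v + (v - a) - (b - v))
      (Metric.ball_mem_nhds v hε)
    rw [hu]
    refine IsPreconnected.union _ ⟨hs, ?_⟩ ⟨hs, ?_⟩ c1 c2
    · have : orient a v (v + (v - a) - (b - v)) = -orient a v b := by
        simp [orient]; ring
      simp only [mem_ofPred_eq, orient_lineMap, orient_self_right, this]
      nlinarith
    · have : orient v b (v + (v - a) - (b - v)) = -orient a v b := by
        simp [orient]; ring
      simp only [mem_ofPred_eq, orient_lineMap, orient_self_outer, this]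
      nlinarith
  · obtain ⟨c, hc, hq⟩ := h.orient_straight h0
    simpa [hq, hc] using c1

theorem isPreconnected_openAngle {a v b : EPlane} (h : IsBend a v b) (ε : ℝ) :
    IsPreconnected (Metric.ball v ε ∩ {q | OpenAngle a v b q}) := by
  by_cases h0 : 0 ≤ orient a v b
  · simp only [OpenAngle, if_pos h0]
    exact ((convex_ball v ε).inter
      ((convex_orient_pos a v).inter (convex_orient_pos v b))).isPreconnected
  · simp only [OpenAngle, if_neg h0]
    exact isPreconnected_orient_pos_or h (not_le.mp h0).le ε

theorem IsBend.symm {a v b : EPlane} (h : IsBend a v b) : IsBend b v a := by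
  refine ⟨h.ne_right, h.ne_left, fun h0 => ?_⟩
  have : orient a v b = 0 := by
    have : orient a v b = -orient b v a := by simp only [orient]; ring
    rw [this, h0, neg_zero]
  obtain ⟨c, hc, hb⟩ := h.straight this
  refine ⟨c⁻¹, by positivity, ?_⟩
  rw [hb, lineMap_apply_module, lineMap_apply_module]
  match_scalars
  · field_simp
  · field_simp
    ring

/-- For an angle of at most `π` the complement is a union of two open half-planes, those to the left
of the reversed path `b → v → a`; for a reflex angle it is an intersection of two, hence convex. -/
theorem isPreconnected_not_closedAngle {a v b : EPlane} (h : IsBend a v b) (ε : ℝ) :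
    IsPreconnected (Metric.ball v ε ∩ {q | ¬ ClosedAngle a v b q}) := by
  have h1 : orient b v a = -orient a v b := by simp only [orient]; ring
  by_cases h0 : 0 ≤ orient a v b
  · simp only [ClosedAngle, if_pos h0]
    have := isPreconnected_orient_pos_or h.symm (by rw [h1]; linarith) ε
    convert this using 4 with q
    rw [orient_swap_left v b, orient_swap_left a v, not_and_or, or_comm]
    simp
  · simp only [ClosedAngle, if_neg h0, not_or, not_le]
    exact ((convex_ball v ε).inter
      ((convex_orient_neg a v).inter (convex_orient_neg v b))).isPreconnected

/-- Near an inner point of the outgoing side, the points to its left are in the open angle. -/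
theorem IsBend.eventually_openAngle {a v b : EPlane} (h : IsBend a v b) {t : ℝ} (ht : 0 < t) :
    ∀ᶠ q in nhds (lineMap v b t : EPlane), 0 < orient v b q → OpenAngle a v b q := by
  unfold OpenAngle
  rcases lt_trichotomy (orient a v b) 0 with h0 | h0 | h0
  · exact Filter.Eventually.of_forall fun q hq => by rw [if_neg h0.not_ge]; exact Or.inr hq
  · obtain ⟨c, hc, hcq⟩ := h.orient_straight h0
    refine Filter.Eventually.of_forall fun q hq => ?_
    rw [if_pos h0.ge]
    rw [hcq] at hq ⊢
    exact ⟨pos_of_mul_pos_right hq hc.le, hq⟩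
  · have : 0 < orient a v (lineMap v b t) := by rw [orient_lineMap_outgoing]; positivity
    filter_upwards [(continuous_orient a v).continuousAt.eventually (lt_mem_nhds this)] with q h1 h2
    rw [if_pos h0.le]
    exact ⟨h1, h2⟩

/-- Near an inner point of the outgoing side, the points to its right are outside of the angle. -/
theorem eventually_not_closedAngle_right {a v b : EPlane} {t : ℝ} (ht : 0 < t) :
    ∀ᶠ q in nhds (lineMap v b t : EPlane), orient v b q < 0 → ¬ ClosedAngle a v b q := by
  unfold ClosedAngle
  by_cases h0 : 0 ≤ orient a v b
  · exact Filter.Eventually.of_forall fun q hq => by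
      rw [if_pos h0]; exact fun h => hq.not_ge h.2
  · have : orient a v (lineMap v b t) < 0 := by
      rw [orient_lineMap_outgoing]; nlinarith [not_le.mp h0]
    filter_upwards [(continuous_orient a v).continuousAt.eventually (gt_mem_nhds this)] with q h1 h2
    rw [if_neg h0, not_or]
    exact ⟨h1.not_ge, h2.not_ge⟩

/-- Near an inner point of the incoming side, the points to its right are outside of the angle. -/
theorem eventually_not_closedAngle_left {a v b : EPlane} {t : ℝ} (ht : 0 < t) :
    ∀ᶠ q in nhds (lineMap v a t : EPlane), orient a v q < 0 → ¬ ClosedAngle a v b q := by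
  unfold ClosedAngle
  by_cases h0 : 0 ≤ orient a v b
  · exact Filter.Eventually.of_forall fun q hq => by
      rw [if_pos h0]; exact fun h => hq.not_ge h.1
  · have : orient v b (lineMap v a t) < 0 := by
      rw [orient_lineMap_incoming]; nlinarith [not_le.mp h0]
    filter_upwards [(continuous_orient v b).continuousAt.eventually (gt_mem_nhds this)] with q h1 h2
    rw [if_neg h0, not_or]
    exact ⟨h2.not_ge, h1.not_ge⟩

/-! ### Combinatorics of simple polygons -/

theorem finRotate_ne_self {n : ℕ} (hn : 2 ≤ n) (i : Fin n) : finRotate n i ≠ i := by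
  obtain ⟨m, rfl⟩ := Nat.exists_eq_add_of_le' hn
  rw [finRotate_apply]
  simp

theorem finRotate_finRotate_ne_self {n : ℕ} (hn : 3 ≤ n) (i : Fin n) :
    finRotate n (finRotate n i) ≠ i := by
  obtain ⟨m, rfl⟩ := Nat.exists_eq_add_of_le' hn
  rw [finRotate_apply, finRotate_apply, add_assoc]
  intro h
  have h2 : (1 + 1 : Fin (m + 2 + 1)) = 0 := by simpa using h
  have := congrArg Fin.val h2
  simp only [Fin.val_add, Fin.val_one, Fin.val_zero] at this
  rw [Nat.mod_eq_of_lt (by omega)] at this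
  omega

theorem forall_of_finRotate {n : ℕ} {P : Fin n → Prop} (h : ∀ i, P i → P (finRotate n i))
    {i : Fin n} (hi : P i) (j : Fin n) : P j := by
  obtain _ | m := n
  · exact i.elim0
  have key : ∀ k : ℕ, P (i + Fin.ofNat (m + 1) k) := by
    intro k
    induction k with
    | zero => simpa using hi
    | succ k ih =>
      have := h _ ih
      rw [finRotate_apply, add_assoc] at this
      convert this using 2
      ext
      simp [Fin.val_add]
  have := key (j - i).val
  simpa using this

namespace Polygon

variable {n : ℕ} {Q : Polygon EPlane n}

theorem edgeSet_eq (Q : Polygon EPlane n) (i : Fin n) :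
    Q.edgeSet ℝ i = segment ℝ (Q i) (Q (finRotate n i)) :=
  affineSegment_eq_segment ℝ _ _

theorem edgeSet_symm_eq (Q : Polygon EPlane n) (i : Fin n) :
    Q.edgeSet ℝ ((finRotate n).symm i) = segment ℝ (Q ((finRotate n).symm i)) (Q i) := by
  rw [edgeSet_eq, Equiv.apply_symm_apply]

theorem isCompact_edgeSet (Q : Polygon EPlane n) (i : Fin n) : IsCompact (Q.edgeSet ℝ i) := by
  rw [edgeSet_eq]; exact isCompact_segment _ _

theorem isCompact_boundary (Q : Polygon EPlane n) : IsCompact (Q.boundary ℝ) :=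
  isCompact_iUnion Q.isCompact_edgeSet

theorem isOpen_compl_boundary (Q : Polygon EPlane n) : IsOpen (Q.boundary ℝ)ᶜ :=
  Q.isCompact_boundary.isClosed.isOpen_compl

theorem mem_boundary {p : EPlane} : p ∈ Q.boundary ℝ ↔ ∃ i, p ∈ Q.edgeSet ℝ i :=
  mem_iUnion

theorem vertex_mem_edgeSet (Q : Polygon EPlane n) (i : Fin n) : Q i ∈ Q.edgeSet ℝ i := by
  rw [edgeSet_eq]; exact left_mem_segment ℝ _ _

theorem vertex_mem_boundary (Q : Polygon EPlane n) (i : Fin n) : Q i ∈ Q.boundary ℝ :=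
  mem_boundary.mpr ⟨i, Q.vertex_mem_edgeSet i⟩

namespace IsSimple

theorem vertex_ne_next (h : Q.IsSimple) (i : Fin n) : Q i ≠ Q (finRotate n i) := fun he =>
  finRotate_ne_self (by have := h.1; omega) i (h.2.1 he).symm

theorem vertex_ne_prev (h : Q.IsSimple) (i : Fin n) : Q i ≠ Q ((finRotate n).symm i) := by
  have := h.vertex_ne_next ((finRotate n).symm i)
  rw [Equiv.apply_symm_apply] at this
  exact this.symm

theorem eq_of_vertex_mem_edgeSet (h : Q.IsSimple) {i j : Fin n} (hm : Q i ∈ Q.edgeSet ℝ j) :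
    j = i ∨ j = (finRotate n).symm i := by
  by_cases hij : j = i
  · exact Or.inl hij
  rcases (h.2.2 j i hij ⟨hm, Q.vertex_mem_edgeSet i⟩).1 with he | he
  · exact absurd (h.2.1 he).symm hij
  · right; rw [Equiv.eq_symm_apply]; exact (h.2.1 he).symm

/-- With at least three vertices the predecessor and successor of `i` differ, so the only common end
of the two edges is `Q i`. -/
theorem eq_vertex_of_mem_of_mem (h : Q.IsSimple) {i : Fin n} {p : EPlane}
    (h1 : p ∈ segment ℝ (Q ((finRotate n).symm i)) (Q i))
    (h2 : p ∈ segment ℝ (Q i) (Q (finRotate n i))) : p = Q i := by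
  have hne : (finRotate n).symm i ≠ i := by
    intro he
    apply finRotate_ne_self (by have := h.1; omega) i
    conv_lhs => rw [← he]
    exact Equiv.apply_symm_apply _ _
  have hne' : (finRotate n).symm i ≠ finRotate n i := by
    intro he
    apply finRotate_finRotate_ne_self h.1 i
    rw [← he, Equiv.apply_symm_apply]
  rw [← edgeSet_symm_eq] at h1
  rw [← edgeSet_eq] at h2
  obtain ⟨ha, hb⟩ := h.2.2 _ _ hne ⟨h1, h2⟩
  rw [Equiv.apply_symm_apply] at ha
  rcases ha with rfl | ha
  · rcases hb with hb | hb
    · exact absurd (h.2.1 hb) hne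
    · exact absurd (h.2.1 hb) hne'
  · exact ha

/-- If the path turned back at `Q i`, the nearer of the two neighbours would lie on the edge to the
farther one, giving the two edges a second common point. -/
theorem isBend (h : Q.IsSimple) (i : Fin n) :
    IsBend (Q ((finRotate n).symm i)) (Q i) (Q (finRotate n i)) := by
  refine ⟨h.vertex_ne_prev i, h.vertex_ne_next i, fun h0 => ?_⟩
  obtain ⟨s, hs⟩ := exists_eq_lineMap_of_orient_eq_zero (h.vertex_ne_prev i)
    (by rw [orient_swap_left, h0, neg_zero])
  rcases lt_trichotomy s 0 with hs0 | hs0 | hs0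
  · exact ⟨-s, by linarith, by rw [neg_neg]; exact hs⟩
  · exact absurd (by rw [hs, hs0, lineMap_apply_zero]) (h.vertex_ne_next i)
  · exfalso
    have key : ∀ p ∈ segment ℝ (Q ((finRotate n).symm i)) (Q i),
        p ∈ segment ℝ (Q i) (Q (finRotate n i)) → p = Q i :=
      fun p => h.eq_vertex_of_mem_of_mem
    rcases le_or_gt s 1 with h1 | h1
    · refine h.vertex_ne_next i (key _ ?_ (right_mem_segment ℝ _ _)).symm
      rw [segment_symm, hs]
      exact lineMap_mem_segment_of_le hs0.le h1
    · refine h.vertex_ne_prev i (key _ (left_mem_segment ℝ _ _) ?_).symm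
      have : Q ((finRotate n).symm i) = lineMap (Q i) (Q (finRotate n i)) s⁻¹ := by
        rw [hs, lineMap_apply_module, lineMap_apply_module]
        match_scalars
        · field_simp
        · field_simp; ring
      rw [this]
      exact lineMap_mem_segment_of_le (by positivity) (inv_le_one_of_one_le₀ h1.le)

/-- Not all vertices lie on one line. -/
theorem exists_orient_ne_zero (h : Q.IsSimple) {a b : EPlane} (hab : a ≠ b) :
    ∃ i, orient a b (Q i) ≠ 0 := by
  by_contra! hz
  choose t ht using fun i => exists_eq_lineMap_of_orient_eq_zero hab (hz i)
  have : Nonempty (Fin n) := ⟨⟨0, by have := h.1; omega⟩⟩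
  -- At the vertex farthest along the line the path cannot turn back, so one of its neighbours would
  -- lie farther still.
  obtain ⟨i, hi⟩ := Finite.exists_max t
  have hc := (h.isBend i)
  have h0 : orient (Q ((finRotate n).symm i)) (Q i) (Q (finRotate n i)) = 0 := by
    rw [ht i, ht (finRotate n i), ht ((finRotate n).symm i)]
    simp only [orient, lineMap_apply_module, PiLp.add_apply, PiLp.smul_apply, smul_eq_mul]
    ring
  obtain ⟨c, hc0, hc⟩ := hc.straight h0
  have h1 := hi (finRotate n i)
  have h2 := hi ((finRotate n).symm i)
  have h3 : (lineMap a b (t (finRotate n i)) : EPlane) =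
      lineMap a b (lineMap (t i) (t ((finRotate n).symm i)) (-c)) := by
    rw [← ht, hc, ht i, ht ((finRotate n).symm i)]
    simp only [lineMap_apply_module]
    module
  have h4 := lineMap_injective ℝ hab h3
  have h5 : t i ≠ t (finRotate n i) := fun he =>
    h.vertex_ne_next i (by rw [ht i, he, ← ht])
  simp only [lineMap_apply_module, smul_eq_mul] at h4
  have : t (finRotate n i) < t i := lt_of_le_of_ne h1 h5.symm
  nlinarith

end IsSimple

/-! ### Membership in the region -/

theorem boundary_subset_region (Q : Polygon EPlane n) : Q.boundary ℝ ⊆ Q.region :=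
  subset_union_left

theorem mem_region_iff_of_notMem_boundary {p : EPlane} (hp : p ∉ Q.boundary ℝ) :
    p ∈ Q.region ↔ Bornology.IsBounded (connectedComponentIn (Q.boundary ℝ)ᶜ p) := by
  simp [region, hp]

/-- A connected set that avoids the boundary is either inside or outside of the polygon. -/
theorem mem_region_iff_of_isPreconnected {S : Set EPlane} (hS : IsPreconnected S)
    (hd : ∀ q ∈ S, q ∉ Q.boundary ℝ) {p q : EPlane} (hp : p ∈ S) (hq : q ∈ S) :
    p ∈ Q.region ↔ q ∈ Q.region := by
  rw [mem_region_iff_of_notMem_boundary (hd p hp), mem_region_iff_of_notMem_boundary (hd q hq),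
    connectedComponentIn_eq
      (hS.subset_connectedComponentIn (F := (Q.boundary ℝ)ᶜ) hp (fun z hz => hd z hz) hq)]

/-- A half-plane beyond the compact boundary is connected and unbounded, so the component containing
it is unbounded. -/
theorem exists_notMem_region (Q : Polygon EPlane n) : ∃ p, p ∉ Q.region := by
  obtain ⟨R, hR⟩ := Q.isCompact_boundary.isBounded.subset_closedBall 0
  have habs : ∀ p : EPlane, p 0 ≤ ‖p‖ := fun p =>
    (le_abs_self _).trans (by simpa using PiLp.norm_apply_le p 0)
  have hd : ∀ q ∈ {q : EPlane | R < q 0}, q ∉ Q.boundary ℝ := by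
    intro q hq hb
    have := hR hb
    rw [mem_closedBall_zero_iff] at this
    exact absurd (lt_of_lt_of_le hq ((habs q).trans this)) (lt_irrefl _)
  have hconv : Convex ℝ {q : EPlane | R < q 0} :=
    convex_halfSpace_gt (f := fun q : EPlane => q 0) ⟨fun _ _ => rfl, fun _ _ => rfl⟩ R
  have hmem : ∀ r : ℝ, R < r → (!₂[r, 0] : EPlane) ∈ {q : EPlane | R < q 0} := by
    intro r hr; simpa using hr
  refine ⟨!₂[R + 1, 0], fun hp => ?_⟩
  have hp0 := hmem (R + 1) (by linarith)
  rw [mem_region_iff_of_notMem_boundary (hd _ hp0)] at hp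
  obtain ⟨C, hC⟩ := hp.subset_closedBall 0
  have hsub := hconv.isPreconnected.subset_connectedComponentIn hp0 (fun z hz => hd z hz)
  have := hC (hsub (hmem (max R C + 1) (by linarith [le_max_left R C])))
  rw [mem_closedBall_zero_iff] at this
  have h2 := (habs _).trans this
  simp at h2
  linarith [le_max_right R C]

/-- Some boundary point is a limit of points outside of the polygon. -/
theorem exists_boundary_frequently_notMem_region (Q : Polygon EPlane n) (i : Fin n) :
    ∃ p ∈ Q.boundary ℝ, ∃ᶠ q in nhds p, q ∉ Q.region := by
  obtain ⟨o, ho⟩ := Q.exists_notMem_region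
  obtain ⟨p, hp⟩ := (nonempty_frontier_iff (s := Q.region)).mpr
    ⟨⟨Q i, Q.boundary_subset_region (Q.vertex_mem_boundary i)⟩, fun h => ho (h ▸ mem_univ o)⟩
  have hp2 : ∃ᶠ q in nhds p, q ∉ Q.region := by
    rw [frontier_eq_closure_inter_closure] at hp
    exact mem_closure_iff_frequently.mp hp.2
  refine ⟨p, ?_, hp2⟩
  -- Off the boundary, a small ball lies entirely inside or entirely outside, so its centre is no
  -- frontier point.
  by_contra hb
  obtain ⟨ε, hε, hball⟩ := Metric.isOpen_iff.mp Q.isOpen_compl_boundary p hb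
  rw [frontier_eq_closure_inter_closure] at hp
  obtain ⟨q, hq, hq'⟩ := (hp2.and_eventually (Metric.ball_mem_nhds p hε)).exists
  obtain ⟨r, hr, hr'⟩ := ((mem_closure_iff_frequently.mp hp.1).and_eventually
    (Metric.ball_mem_nhds p hε)).exists
  exact hq ((mem_region_iff_of_isPreconnected (convex_ball p ε).isPreconnected
    (fun z hz => hball hz) hr' hq').mp hr)

end Polygon

namespace Polygon

variable {n : ℕ} {Q : Polygon EPlane n}

/-! ### The polygon near an inner point of an edge -/

theorem _root_.orient_eq_zero_of_mem_openSegment {a b p : EPlane} (h : p ∈ openSegment ℝ a b) :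
    orient a b p = 0 :=
  orient_eq_zero_of_mem_segment (openSegment_subset_segment ℝ _ _ h)

/-- Near an inner point of a segment, all points of its line are on the segment. -/
theorem _root_.eventually_mem_segment {a b p : EPlane} (hab : a ≠ b) (hp : p ∈ openSegment ℝ a b) :
    ∀ᶠ q in nhds p, orient a b q = 0 → q ∈ segment ℝ a b := by
  rw [openSegment_eq_image_lineMap] at hp
  obtain ⟨t, ⟨ht0, ht1⟩, rfl⟩ := hp
  have hd : 0 < dist a b := dist_pos.mpr hab
  -- Within this radius the parameter on the line moves by less than its distance to `0` and to `1`.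
  have hm : 0 < min t (1 - t) * dist a b := mul_pos (lt_min ht0 (by linarith)) hd
  filter_upwards [Metric.ball_mem_nhds _ hm] with q hq h0
  obtain ⟨s, rfl⟩ := exists_eq_lineMap_of_orient_eq_zero hab h0
  rw [Metric.mem_ball, dist_lineMap_lineMap, mul_lt_mul_iff_left₀ hd, Real.dist_eq, abs_lt] at hq
  exact lineMap_mem_segment_of_le (by linarith [min_le_left t (1 - t)])
    (by linarith [min_le_right t (1 - t)])

namespace IsSimple

theorem eq_of_mem_openSegment (h : Q.IsSimple) {i j : Fin n} {p : EPlane}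
    (hp : p ∈ openSegment ℝ (Q i) (Q (finRotate n i))) (hj : p ∈ Q.edgeSet ℝ j) : j = i := by
  by_contra hij
  have hi : p ∈ Q.edgeSet ℝ i := by
    rw [edgeSet_eq]; exact openSegment_subset_segment ℝ _ _ hp
  rcases (h.2.2 j i hij ⟨hj, hi⟩).2 with rfl | he
  · exact h.vertex_ne_next i (left_mem_openSegment_iff.mp hp)
  · rw [mem_singleton_iff.mp he] at hp
    exact h.vertex_ne_next i (right_mem_openSegment_iff.mp hp)

/-- The points to the right of and close to an inner part of an edge are all inside or all outside
of the polygon. -/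
theorem exists_thickening_right (h : Q.IsSimple) {i : Fin n} {p₁ p₂ : EPlane}
    (h₁ : p₁ ∈ openSegment ℝ (Q i) (Q (finRotate n i)))
    (h₂ : p₂ ∈ openSegment ℝ (Q i) (Q (finRotate n i))) :
    ∃ δ : ℝ, 0 < δ ∧ ∀ q ∈ Metric.thickening δ (segment ℝ p₁ p₂),
      ∀ r ∈ Metric.thickening δ (segment ℝ p₁ p₂),
      orient (Q i) (Q (finRotate n i)) q < 0 → orient (Q i) (Q (finRotate n i)) r < 0 →
      (q ∈ Q.region ↔ r ∈ Q.region) := by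
  have hsub : segment ℝ p₁ p₂ ⊆ openSegment ℝ (Q i) (Q (finRotate n i)) :=
    (convex_openSegment _ _).segment_subset h₁ h₂
  -- The other edges form a closed set disjoint from the compact segment `p₁ p₂`, so a whole
  -- `δ`-neighbourhood of the segment misses them.
  have hopen : IsOpen (⋃ j ∈ {j | j ≠ i}, Q.edgeSet ℝ j)ᶜ :=
    ((toFinite {j | j ≠ i}).isCompact_biUnion
      fun j _ => Q.isCompact_edgeSet j).isClosed.isOpen_compl
  obtain ⟨δ, hδ, hthick⟩ := (isCompact_segment p₁ p₂).exists_thickening_subset_open hopen (by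
    intro p hp hj
    simp only [mem_iUnion] at hj
    obtain ⟨j, hji, hj⟩ := hj
    exact hji (h.eq_of_mem_openSegment (hsub hp) hj))
  refine ⟨δ, hδ, fun q hq r hr hq' hr' => ?_⟩
  refine mem_region_iff_of_isPreconnected
    (S := Metric.thickening δ (segment ℝ p₁ p₂) ∩ {q | orient (Q i) (Q (finRotate n i)) q < 0})
    (((convex_segment _ _).thickening δ).inter (convex_orient_neg _ _)).isPreconnected
    ?_ ⟨hq, hq'⟩ ⟨hr, hr'⟩
  rintro z ⟨hz, hz'⟩ hb
  obtain ⟨j, hj⟩ := mem_boundary.mp hb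
  by_cases hji : j = i
  · subst hji
    rw [edgeSet_eq] at hj
    exact absurd (orient_eq_zero_of_mem_segment hj) (ne_of_lt hz')
  · exact hthick hz (mem_biUnion (s := {j | j ≠ i}) hji hj)

end IsSimple

/-- The points close to and to the right of inner points of the `i`-th edge are not in
the polygon. -/
def RightOutside (Q : Polygon EPlane n) (i : Fin n) : Prop :=
  ∀ p ∈ openSegment ℝ (Q i) (Q (finRotate n i)),
    ∀ᶠ q in nhds p, orient (Q i) (Q (finRotate n i)) q < 0 → q ∉ Q.region

theorem IsCounterclockwise.eventually_mem_region (hc : Q.IsCounterclockwise) (h : Q.IsSimple)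
    {i : Fin n} {p : EPlane} (hp : p ∈ openSegment ℝ (Q i) (Q (finRotate n i))) :
    ∀ᶠ q in nhds p, 0 ≤ orient (Q i) (Q (finRotate n i)) q → q ∈ Q.region := by
  filter_upwards [hc i p hp, eventually_mem_segment (h.vertex_ne_next i) hp] with q h1 h2 h3
  rcases h3.eq_or_lt with h3 | h3
  · exact Q.boundary_subset_region (mem_boundary.mpr ⟨i, by rw [edgeSet_eq]; exact h2 h3.symm⟩)
  · exact h1 h3

/-- Outside points near `p` must lie strictly right of the edge, and `exists_thickening_right`
carries them along the edge to every inner point `r`. -/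
theorem IsCounterclockwise.rightOutside (hc : Q.IsCounterclockwise) (h : Q.IsSimple)
    {i : Fin n} {p : EPlane} (hp : p ∈ openSegment ℝ (Q i) (Q (finRotate n i)))
    (hf : ∃ᶠ q in nhds p, q ∉ Q.region) : Q.RightOutside i := by
  intro r hr
  obtain ⟨δ, hδ, hst⟩ := h.exists_thickening_right hp hr
  have hball : ∀ s ∈ segment ℝ p r, ∀ᶠ q in nhds s, q ∈ Metric.thickening δ (segment ℝ p r) :=
    fun s hs => Metric.isOpen_thickening.mem_nhds (Metric.self_subset_thickening hδ _ hs)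
  obtain ⟨q, hq, hq1, hq2⟩ := (hf.and_eventually ((hball p (left_mem_segment ℝ _ _)).and
    (hc.eventually_mem_region h hp))).exists
  have hq3 : orient (Q i) (Q (finRotate n i)) q < 0 := by
    by_contra! hq3; exact hq (hq2 hq3)
  filter_upwards [hball r (right_mem_segment ℝ _ _)] with z hz hz'
  rwa [← hst q hq1 z hz hq3 hz']

/-! ### The polygon near a vertex -/

theorem inAngle_iff {i : Fin n} {p : EPlane} :
    Q.InAngle i p ↔ ClosedAngle (Q ((finRotate n).symm i)) (Q i) (Q (finRotate n i)) p :=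
  Iff.rfl

/-- The direction from the vertex `Q i` to `p` lies in the open interior angle at `Q i`. -/
def InOpenAngle (Q : Polygon EPlane n) (i : Fin n) (p : EPlane) : Prop :=
  OpenAngle (Q ((finRotate n).symm i)) (Q i) (Q (finRotate n i)) p

/-- Close to a vertex, the boundary consists of the two sides of the angle. -/
theorem IsSimple.exists_ball_mem_boundary_iff (h : Q.IsSimple) (i : Fin n) :
    ∃ ε : ℝ, 0 < ε ∧ ∀ q ∈ Metric.ball (Q i) ε,
      (q ∈ Q.boundary ℝ ↔ Q.InAngle i q ∧ ¬ Q.InOpenAngle i q) := by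
  have h1 : ∀ᶠ q in nhds (Q i), ∀ j, q ∈ Q.edgeSet ℝ j → j = i ∨ j = (finRotate n).symm i := by
    rw [Filter.eventually_all]
    intro j
    by_cases hj : Q i ∈ Q.edgeSet ℝ j
    · exact Filter.Eventually.of_forall fun _ _ => h.eq_of_vertex_mem_edgeSet hj
    · filter_upwards [(Q.isCompact_edgeSet j).isClosed.isOpen_compl.mem_nhds hj] with q hq hq'
      exact absurd hq' hq
  have h2 : ∀ᶠ q in nhds (Q i), dist q (Q i) < dist (Q i) (Q ((finRotate n).symm i)) :=
    Metric.ball_mem_nhds (Q i) (dist_pos.mpr (h.vertex_ne_prev i))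
  have h3 : ∀ᶠ q in nhds (Q i), dist q (Q i) < dist (Q i) (Q (finRotate n i)) :=
    Metric.ball_mem_nhds (Q i) (dist_pos.mpr (h.vertex_ne_next i))
  obtain ⟨ε, hε, hall⟩ := Metric.eventually_nhds_iff_ball.mp (h1.and (h2.and h3))
  refine ⟨ε, hε, fun q hq => ?_⟩
  obtain ⟨g1, g2, g3⟩ := hall q hq
  constructor
  · intro hb
    obtain ⟨j, hj⟩ := mem_boundary.mp hb
    rcases g1 j hj with rfl | rfl
    · rw [edgeSet_eq] at hj
      exact closedAngle_and_not_openAngle_of_mem_segment_right hj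
    · rw [edgeSet_symm_eq] at hj
      exact closedAngle_and_not_openAngle_of_mem_segment_left hj
  · rintro ⟨hcl, hop⟩
    rcases (h.isBend i).mem_segment hcl hop g2 g3 with hs | hs
    · rw [← edgeSet_symm_eq] at hs
      exact mem_boundary.mpr ⟨_, hs⟩
    · rw [← edgeSet_eq] at hs
      exact mem_boundary.mpr ⟨_, hs⟩

theorem exists_lineMap_mem_ball {v b : EPlane} {ε : ℝ} (hε : 0 < ε) :
    ∃ t : ℝ, 0 < t ∧ lineMap v b t ∈ openSegment ℝ v b ∧ lineMap v b t ∈ Metric.ball v ε := by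
  obtain ⟨t, h0, h1, h2⟩ := exists_lineMap_of_eventually b (Metric.ball_mem_nhds v hε)
  exact ⟨t, h0, by rw [openSegment_eq_image_lineMap]; exact ⟨t, ⟨h0, h1⟩, rfl⟩, h2⟩

/-- Close to a vertex, the closed interior angle is inside of the polygon, and its complement is
entirely inside or entirely outside. -/
theorem IsCounterclockwise.exists_ball_vertex (hc : Q.IsCounterclockwise) (h : Q.IsSimple)
    (i : Fin n) : ∃ ε : ℝ, 0 < ε ∧
      (∀ q ∈ Metric.ball (Q i) ε, Q.InAngle i q → q ∈ Q.region) ∧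
      ∀ q ∈ Metric.ball (Q i) ε, ∀ r ∈ Metric.ball (Q i) ε, ¬ Q.InAngle i q → ¬ Q.InAngle i r →
        (q ∈ Q.region ↔ r ∈ Q.region) := by
  obtain ⟨ε, hε, hb⟩ := h.exists_ball_mem_boundary_iff i
  refine ⟨ε, hε, fun q hq hcl => ?_, fun q hq r hr hq' hr' => ?_⟩
  · by_cases hop : Q.InOpenAngle i q
    -- The open angle in the ball is connected and free of boundary points, so one inside point is
    -- enough: take one just left of the outgoing edge.
    · obtain ⟨t, ht, hto, htb⟩ := exists_lineMap_mem_ball (v := Q i) (b := Q (finRotate n i)) hε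
      obtain ⟨r, hr, hr1, hr2, hr3⟩ := exists_orient_pos_of_eventually (h.vertex_ne_next i)
        (orient_eq_zero_of_mem_openSegment hto)
        (((h.isBend i).eventually_openAngle ht).and ((hc i _ hto).and
          (Metric.isOpen_ball.mem_nhds htb)))
      refine (mem_region_iff_of_isPreconnected (isPreconnected_openAngle (h.isBend i) ε) ?_
        ⟨hr3, hr1 hr⟩ ⟨hq, hop⟩).mp (hr2 hr)
      rintro z ⟨hz, hz'⟩ hzb
      exact ((hb z hz).mp hzb).2 hz'
    · exact Q.boundary_subset_region ((hb q hq).mpr ⟨hcl, hop⟩)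
  · refine mem_region_iff_of_isPreconnected (isPreconnected_not_closedAngle (h.isBend i) ε) ?_
      ⟨hq, hq'⟩ ⟨hr, hr'⟩
    rintro z ⟨hz, hz'⟩ hzb
    exact hz' ((hb z hz).mp hzb).1

/-- An outside point near the vertex lies in the exterior angle, which is then entirely outside
nearby and reaches the right side of the outgoing edge. -/
theorem IsCounterclockwise.rightOutside_of_frequently_vertex (hc : Q.IsCounterclockwise)
    (h : Q.IsSimple) {i : Fin n} (hf : ∃ᶠ q in nhds (Q i), q ∉ Q.region) : Q.RightOutside i := by
  obtain ⟨ε, hε, hin, hst⟩ := hc.exists_ball_vertex h i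
  obtain ⟨q, hq, hqb⟩ := (hf.and_eventually (Metric.ball_mem_nhds _ hε)).exists
  obtain ⟨t, ht, hto, htb⟩ := exists_lineMap_mem_ball (v := Q i) (b := Q (finRotate n i)) hε
  refine hc.rightOutside h hto fun hE => ?_
  obtain ⟨r, hr, hr1, hr2, hr3⟩ := exists_orient_neg_of_eventually (h.vertex_ne_next i)
    (orient_eq_zero_of_mem_openSegment hto)
    (hE.and ((eventually_not_closedAngle_right (a := Q ((finRotate n).symm i)) ht).and
      (Metric.isOpen_ball.mem_nhds htb)))
  exact hr1 fun hr' => hq ((hst r hr3 q hqb (hr2 hr) fun hq' => hq (hin q hqb hq')).mp hr')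

/-- The right side of the incoming edge supplies an outside point of the exterior angle, which by
`exists_ball_vertex` decides the whole exterior angle near the vertex. -/
theorem IsCounterclockwise.eventually_vertex (hc : Q.IsCounterclockwise)
    (h : Q.IsSimple) {i : Fin n} (ho : Q.RightOutside ((finRotate n).symm i)) :
    ∀ᶠ q in nhds (Q i), q ∈ Q.region ↔ Q.InAngle i q := by
  obtain ⟨ε, hε, hin, hst⟩ := hc.exists_ball_vertex h i
  obtain ⟨t, ht, hto, htb⟩ :=
    exists_lineMap_mem_ball (v := Q i) (b := Q ((finRotate n).symm i)) hε
  rw [openSegment_symm] at hto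
  have ho' := ho
  unfold RightOutside at ho'
  rw [Equiv.apply_symm_apply] at ho'
  obtain ⟨r, hr, hr1, hr2, hr3⟩ := exists_orient_neg_of_eventually (h.vertex_ne_prev i).symm
    (orient_eq_zero_of_mem_openSegment hto)
    ((ho' _ hto).and ((eventually_not_closedAngle_left (b := Q (finRotate n i)) ht).and
      (Metric.isOpen_ball.mem_nhds htb)))
  filter_upwards [Metric.ball_mem_nhds (Q i) hε] with q hq
  refine ⟨fun hqr => ?_, hin q hq⟩
  by_contra hq'
  exact hr1 hr ((hst q hq r hr3 hq' (hr2 hr)).mp hqr)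

/-- The induction step around the boundary cycle, through the exterior angle at the common vertex.
-/
theorem IsCounterclockwise.rightOutside_next (hc : Q.IsCounterclockwise)
    (h : Q.IsSimple) {i : Fin n} (ho : Q.RightOutside i) : Q.RightOutside (finRotate n i) := by
  have hv := hc.eventually_vertex h (i := finRotate n i) (by rwa [Equiv.symm_apply_apply])
  refine hc.rightOutside_of_frequently_vertex h fun hE => ?_
  obtain ⟨ε, hε, hball⟩ := Metric.eventually_nhds_iff_ball.mp (hE.and hv)
  obtain ⟨t, ht, hto, htb⟩ := exists_lineMap_mem_ball
    (v := Q (finRotate n i)) (b := Q (finRotate n (finRotate n i))) hε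
  obtain ⟨r, hr, hr1, hr2⟩ := exists_orient_neg_of_eventually (h.vertex_ne_next (finRotate n i))
    (orient_eq_zero_of_mem_openSegment hto)
    ((eventually_not_closedAngle_right
      (a := Q ((finRotate n).symm (finRotate n i))) ht).and (Metric.isOpen_ball.mem_nhds htb))
  obtain ⟨g1, g2⟩ := hball r hr2
  exact hr1 hr (g2.mp (not_not.mp g1))

theorem IsCounterclockwise.rightOutside_all (hc : Q.IsCounterclockwise) (h : Q.IsSimple)
    (i : Fin n) : Q.RightOutside i := by
  obtain ⟨p, hp, hf⟩ := Q.exists_boundary_frequently_notMem_region i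
  obtain ⟨j, hj⟩ := mem_boundary.mp hp
  have key : ∃ k, Q.RightOutside k := by
    rw [edgeSet_eq, ← insert_endpoints_openSegment] at hj
    rcases hj with rfl | rfl | hj
    · exact ⟨_, hc.rightOutside_of_frequently_vertex h hf⟩
    · exact ⟨_, hc.rightOutside_of_frequently_vertex h hf⟩
    · exact ⟨_, hc.rightOutside h hj hf⟩
  obtain ⟨k, hk⟩ := key
  exact forall_of_finRotate (P := Q.RightOutside) (fun i => hc.rightOutside_next h) hk i

/-- Near a vertex, the polygon coincides with its closed interior angle. -/
theorem IsCounterclockwise.eventually_mem_region_iff_inAngle (hc : Q.IsCounterclockwise)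
    (h : Q.IsSimple) (i : Fin n) : ∀ᶠ q in nhds (Q i), q ∈ Q.region ↔ Q.InAngle i q :=
  hc.eventually_vertex h (hc.rightOutside_all h _)

/-- Near an inner point of an edge, the polygon coincides with the closed half-plane to the left
of the edge. -/
theorem IsCounterclockwise.eventually_mem_region_iff_orient (hc : Q.IsCounterclockwise)
    (h : Q.IsSimple) {i : Fin n} {p : EPlane}
    (hp : p ∈ openSegment ℝ (Q i) (Q (finRotate n i))) :
    ∀ᶠ q in nhds p, q ∈ Q.region ↔ 0 ≤ orient (Q i) (Q (finRotate n i)) q := by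
  filter_upwards [hc.eventually_mem_region h hp, hc.rightOutside_all h i p hp] with q h1 h2
  exact ⟨fun hq => by by_contra! hlt; exact h2 hlt hq, h1⟩

end Polygon

/-! ### Crossing segments -/

/-- Each orientation now has the fixed line in its first two arguments, the form in which
`orient_lineMap` applies. -/
theorem segmentsCross_iff {x y z w : EPlane} : SegmentsCross x y z w ↔
    orient z w x * orient z w y < 0 ∧ orient x y z * orient x y w < 0 := by
  rw [SegmentsCross, ← orient_rotate x z w, ← orient_rotate y z w, orient_rotate z x y,
    orient_rotate w x y]

theorem exists_mem_Ioo_of_mul_neg {a b : ℝ} (h : a * b < 0) :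
    ∃ t ∈ Ioo (0 : ℝ) 1, (1 - t) * a + t * b = 0 := by
  have hne : a - b ≠ 0 := by
    intro h0
    have : a = b := by linarith
    subst this
    nlinarith [mul_self_nonneg a]
  rcases mul_neg_iff.mp h with ⟨ha, hb⟩ | ⟨ha, hb⟩
  · have hd : 0 < a - b := by linarith
    exact ⟨a / (a - b), ⟨by positivity, by rw [div_lt_one hd]; linarith⟩, by field_simp; ring⟩
  · have hd : 0 < b - a := by linarith
    refine ⟨-a / (b - a), ⟨div_pos (by linarith) hd, by rw [div_lt_one hd]; linarith⟩, ?_⟩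
    field_simp; ring

/-- Crossing segments meet in a point interior to both. -/
theorem SegmentsCross.exists_mem {x y z w : EPlane} (h : SegmentsCross x y z w) :
    ∃ p ∈ openSegment ℝ x y, p ∈ openSegment ℝ z w := by
  obtain ⟨h1, h2⟩ := segmentsCross_iff.mp h
  have hzw : z ≠ w := by
    rintro rfl
    nlinarith [mul_self_nonneg (orient x y z)]
  obtain ⟨t, ht, ht0⟩ := exists_mem_Ioo_of_mul_neg h1
  rw [← orient_lineMap] at ht0
  obtain ⟨u, hu⟩ := exists_eq_lineMap_of_orient_eq_zero hzw ht0
  refine ⟨lineMap x y t, by rw [openSegment_eq_image_lineMap]; exact ⟨t, ht, rfl⟩, ?_⟩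
  have hu0 : (1 - u) * orient x y z + u * orient x y w = 0 := by
    rw [← orient_lineMap, ← hu]; simp [orient_lineMap]
  rw [openSegment_eq_image_lineMap]
  refine ⟨u, ?_, hu.symm⟩
  rcases mul_neg_iff.mp h2 with ⟨ha, hb⟩ | ⟨ha, hb⟩ <;> constructor <;> by_contra! hc <;> nlinarith

/-- Segments with a common inner point cross unless they are parallel. -/
theorem segmentsCross_of_mem {x y z w p : EPlane} (hxy : p ∈ openSegment ℝ x y)
    (hzw : p ∈ openSegment ℝ z w) (h : orient z w x ≠ 0) : SegmentsCross x y z w := by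
  have h1 := orient_eq_zero_of_mem_segment (openSegment_subset_segment ℝ _ _ hxy)
  have h2 := orient_eq_zero_of_mem_segment (openSegment_subset_segment ℝ _ _ hzw)
  rw [openSegment_eq_image_lineMap] at hxy hzw
  obtain ⟨t, ⟨ht0, ht1⟩, rfl⟩ := hxy
  obtain ⟨u, ⟨hu0, hu1⟩, hu⟩ := hzw
  rw [← hu, orient_lineMap] at h1
  rw [orient_lineMap] at h2
  -- Both sides are the cross product of `w - z` and `y - x`. If `z` and `w` lie on the line `xy`,
  -- it vanishes, which forces `x` onto the line `zw`.
  have key : orient z w y - orient z w x = orient x y z - orient x y w := by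
    simp only [orient]; ring
  have neg : ∀ {s a b : ℝ}, 0 < s → s < 1 → (1 - s) * a + s * b = 0 → a ≠ 0 → a * b < 0 := by
    intro s a b hs0 hs1 he ha
    have h3 : s * (a * b) = -((1 - s) * a ^ 2) := by linear_combination a * he
    have h4 : 0 < (1 - s) * a ^ 2 := mul_pos (by linarith) (by positivity)
    by_contra! h5
    nlinarith [mul_nonneg hs0.le h5]
  refine segmentsCross_iff.mpr ⟨neg ht0 ht1 h2 h, neg hu0 hu1 h1 fun hz => h ?_⟩
  have hw : orient x y w = 0 := by
    rw [hz, mul_zero, zero_add] at h1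
    exact (mul_eq_zero.mp h1).resolve_left hu0.ne'
  rw [hz, hw] at key
  linear_combination h2 - t * key

/-! ### Visible segments and the local conditions -/

namespace Polygon

variable {n : ℕ} {Q : Polygon EPlane n}

theorem IsSimple.vertex_notMem_openSegment (h : Q.IsSimple) (i j : Fin n) :
    Q j ∉ openSegment ℝ (Q i) (Q (finRotate n i)) := by
  intro hm
  have h1 := h.eq_of_mem_openSegment hm (Q.vertex_mem_edgeSet j)
  subst h1
  exact h.vertex_ne_next j (left_mem_openSegment_iff.mp hm)

/-- A segment of the polygon leaves every vertex on it into the closed interior angle. -/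
theorem IsCounterclockwise.inAngle_of_segment_subset (hc : Q.IsCounterclockwise) (h : Q.IsSimple)
    {x y : EPlane} (hxy : segment ℝ x y ⊆ Q.region) {i : Fin n} (hi : Q i ∈ segment ℝ x y) :
    Q.InAngle i x := by
  obtain ⟨s, hs0, hs1, hs⟩ :=
    exists_lineMap_of_eventually x (hc.eventually_mem_region_iff_inAngle h i)
  have := hs.mp (hxy ((convex_segment x y).segment_subset hi (left_mem_segment ℝ x y)
    (lineMap_mem_segment_of_le hs0.le hs1.le)))
  exact (ClosedAngle.lineMap_iff hs0).mp this

/-- No edge strictly crosses a segment of the polygon. -/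
theorem IsCounterclockwise.not_segmentsCross_of_segment_subset (hc : Q.IsCounterclockwise)
    (h : Q.IsSimple) {x y : EPlane} (hxy : segment ℝ x y ⊆ Q.region) (i : Fin n) :
    ¬ SegmentsCross x y (Q i) (Q (finRotate n i)) := by
  intro hcr
  obtain ⟨p, hp, hp'⟩ := hcr.exists_mem
  have key : ∀ e ∈ segment ℝ x y, ¬ orient (Q i) (Q (finRotate n i)) e < 0 := by
    intro e he hneg
    obtain ⟨s, hs0, hs1, hs⟩ :=
      exists_lineMap_of_eventually e (hc.eventually_mem_region_iff_orient h hp')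
    have := hs.mp (hxy ((convex_segment x y).segment_subset
      (openSegment_subset_segment ℝ _ _ hp) he (lineMap_mem_segment_of_le hs0.le hs1.le)))
    rw [orient_lineMap, orient_eq_zero_of_mem_openSegment hp'] at this
    nlinarith
  have h1 := (segmentsCross_iff.mp hcr).1
  rcases mul_neg_iff.mp h1 with ⟨-, hb⟩ | ⟨ha, -⟩
  · exact key y (right_mem_segment ℝ x y) hb
  · exact key x (left_mem_segment ℝ x y) ha

/-- A segment between two vertices which is in the closed interior angle at each vertex on it and
not crossed by an edge is contained in the polygon. -/
theorem IsCounterclockwise.segment_subset_region (hc : Q.IsCounterclockwise) (h : Q.IsSimple)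
    {k l : Fin n} (hang : ∀ i, Q i ∈ segment ℝ (Q k) (Q l) → Q.InAngle i (Q l))
    (hcross : ∀ i, ¬ SegmentsCross (Q k) (Q l) (Q i) (Q (finRotate n i))) :
    segment ℝ (Q k) (Q l) ⊆ Q.region := by
  intro p hp
  by_cases hpb : p ∈ Q.boundary ℝ
  · exact Q.boundary_subset_region hpb
  -- The first boundary point on the way from `p` to `Q k`; there is one because `Q k` itself is on
  -- the boundary.
  obtain ⟨t, ⟨⟨ht0, ht1⟩, htb⟩, hmin⟩ := IsCompact.exists_isLeast
    (s := Icc (0 : ℝ) 1 ∩ (fun s : ℝ => (lineMap p (Q k) s : EPlane)) ⁻¹' Q.boundary ℝ)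
    (isCompact_Icc.inter_right (Q.isCompact_boundary.isClosed.preimage lineMap_continuous))
    ⟨1, ⟨zero_le_one, le_rfl⟩, by simpa using Q.vertex_mem_boundary k⟩
  have htb' : (lineMap p (Q k) t : EPlane) ∈ Q.boundary ℝ := htb
  have htpos : 0 < t := lt_of_le_of_ne ht0 (by rintro rfl; exact hpb (by simpa using htb'))
  obtain ⟨q, hq⟩ : ∃ q : EPlane, q = lineMap p (Q k) t := ⟨_, rfl⟩
  rw [← hq] at htb'
  have hqseg : q ∈ segment ℝ (Q k) (Q l) := by
    rw [hq]
    exact (convex_segment _ _).segment_subset hp (left_mem_segment ℝ _ _)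
      (lineMap_mem_segment_of_le ht0 ht1)
  have hfree : ∀ r ∈ (fun s : ℝ => (lineMap q p s : EPlane)) '' Ioc 0 1, r ∉ Q.boundary ℝ := by
    rintro _ ⟨s, ⟨hs0, hs1⟩, rfl⟩ hb
    have he : (lineMap q p s : EPlane) = lineMap p (Q k) (t * (1 - s)) := by
      rw [hq]; simp only [lineMap_apply_module]; module
    replace hb : (lineMap q p s : EPlane) ∈ Q.boundary ℝ := hb
    rw [he] at hb
    have hle : t * (1 - s) ≤ 1 := by nlinarith
    have : t ≤ t * (1 - s) := hmin ⟨⟨mul_nonneg ht0 (by linarith), hle⟩, hb⟩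
    nlinarith [mul_pos htpos hs0]
  have hconn : IsPreconnected ((fun s : ℝ => (lineMap q p s : EPlane)) '' Ioc 0 1) :=
    isPreconnected_Ioc.image _ lineMap_continuous.continuousOn
  suffices hnear : ∃ s : ℝ, 0 < s ∧ s < 1 ∧ (lineMap q p s : EPlane) ∈ Q.region by
    obtain ⟨s, hs0, hs1, hs⟩ := hnear
    exact (mem_region_iff_of_isPreconnected hconn hfree ⟨s, ⟨hs0, hs1.le⟩, rfl⟩
      ⟨1, ⟨one_pos, le_rfl⟩, by simp⟩).mp hs
  have hvertex : ∀ i, q = Q i → ∃ s : ℝ, 0 < s ∧ s < 1 ∧ (lineMap q p s : EPlane) ∈ Q.region := by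
    intro i hi
    obtain ⟨s, hs0, hs1, hs⟩ := exists_lineMap_of_eventually p
      (hi ▸ hc.eventually_mem_region_iff_inAngle h i : ∀ᶠ z in nhds q, z ∈ Q.region ↔ Q.InAngle i z)
    refine ⟨s, hs0, hs1, hs.mpr ?_⟩
    rw [hi, inAngle_iff, ClosedAngle.lineMap_iff hs0]
    have hl := inAngle_iff.mp (hang i (hi ▸ hqseg))
    rw [segment_eq_image_lineMap] at hp
    obtain ⟨u, ⟨hu0, hu1⟩, rfl⟩ := hp
    have hupos : 0 < u := lt_of_le_of_ne hu0 (by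
      rintro rfl
      exact hpb (by simpa using Q.vertex_mem_boundary k))
    -- On the segment from `Q k` to `Q l`, `p` has parameter `u` and `q` has parameter `u * (1 -
    -- t)`. Hence `p` is at the fraction `u * t / (1 - u * (1 - t))` of the way from `q` to `Q l`,
    -- in the same direction from `q`.
    have hd : 0 < 1 - u * (1 - t) := by nlinarith
    have he : (lineMap (Q k) (Q l) u : EPlane) =
        lineMap (Q i) (Q l) (u * t / (1 - u * (1 - t))) := by
      rw [← hi, hq]
      simp only [lineMap_apply_module]
      match_scalars <;> field_simp <;> ring
    rw [he, ClosedAngle.lineMap_iff (by positivity)]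
    exact hl
  obtain ⟨j, hj⟩ := mem_boundary.mp htb'
  rw [edgeSet_eq, ← insert_endpoints_openSegment] at hj
  rcases hj with hj | hj | hj
  · exact hvertex _ hj
  · exact hvertex _ hj
  have hqk : q ≠ Q k := by rintro rfl; exact h.vertex_notMem_openSegment _ _ hj
  have hql : q ≠ Q l := by rintro rfl; exact h.vertex_notMem_openSegment _ _ hj
  have hqo : q ∈ openSegment ℝ (Q k) (Q l) := by
    rw [← insert_endpoints_openSegment] at hqseg
    exact (hqseg.resolve_left hqk).resolve_left hql
  -- Without a crossing, the segment through the inner point `q` of the edge can only run along the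
  -- line of that edge.
  have hk0 : orient (Q j) (Q (finRotate n j)) (Q k) = 0 := by
    by_contra hne
    exact hcross j (segmentsCross_of_mem hqo hj hne)
  have hp0 : orient (Q j) (Q (finRotate n j)) p = 0 := by
    have h0 := orient_eq_zero_of_mem_openSegment hj
    rw [hq, orient_lineMap, hk0, mul_zero, add_zero] at h0
    refine (mul_eq_zero.mp h0).resolve_left fun ht => hqk ?_
    obtain rfl : t = 1 := by linarith
    simpa using hq
  obtain ⟨s, hs0, hs1, hs⟩ :=
    exists_lineMap_of_eventually p (hc.eventually_mem_region_iff_orient h hj)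
  refine ⟨s, hs0, hs1, hs.mpr ?_⟩
  rw [orient_lineMap, hp0, orient_eq_zero_of_mem_openSegment hj]
  simp

/-- The local characterization of the edges of the visibility graph. -/
theorem IsCounterclockwise.visibilityGraph_adj_iff (hc : Q.IsCounterclockwise) (h : Q.IsSimple)
    {x y : Q.vertexSet} (hxy : x ≠ y) :
    Q.visibilityGraph.Adj x y ↔
      (∀ i : Fin n, Q i ∈ segment ℝ (x : EPlane) (y : EPlane) →
        Q.InAngle i x ∧ Q.InAngle i y) ∧
      ∀ i : Fin n, ¬ SegmentsCross x y (Q i) (Q (finRotate n i)) := by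
  have hadj : Q.visibilityGraph.Adj x y ↔ segment ℝ (x : EPlane) (y : EPlane) ⊆ Q.region := by
    rw [← disjoint_compl_right_iff_subset]
    exact and_iff_right hxy
  rw [hadj]
  constructor
  · intro hsub
    refine ⟨fun i hi => ⟨hc.inAngle_of_segment_subset h hsub hi, ?_⟩,
      hc.not_segmentsCross_of_segment_subset h hsub⟩
    rw [segment_symm] at hsub hi
    exact hc.inAngle_of_segment_subset h hsub hi
  · rintro ⟨hang, hcross⟩
    obtain ⟨_, k, rfl⟩ := x
    obtain ⟨_, l, rfl⟩ := y
    exact hc.segment_subset_region h (fun i hi => (hang i hi).2) hcross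

/-! ### Definability of the visibility graph -/

/-- Betweenness is determined by the order type and a point outside of the line. -/
theorem IsSimple.mem_segment_iff (h : Q.IsSimple) {x y v : EPlane} (hxy : x ≠ y) :
    v ∈ segment ℝ x y ↔ v = x ∨ v = y ∨ (orient x y v = 0 ∧
      ∃ i, 0 < orient (Q i) x v * orient (Q i) v y) := by
  -- For `w` off the line, the sign of this product is that of `t * (1 - t)`, so it detects
  -- betweenness.
  have key : ∀ (w : EPlane) (t : ℝ), orient w x (lineMap x y t) * orient w (lineMap x y t) y =
      t * (1 - t) * orient x y w ^ 2 := by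
    intro w t
    simp only [orient, lineMap_apply_module, PiLp.add_apply, PiLp.smul_apply, smul_eq_mul]
    ring
  constructor
  · intro hv
    have h0 := orient_eq_zero_of_mem_segment hv
    rw [← insert_endpoints_openSegment] at hv
    rcases hv with hv | hv | hv
    · exact Or.inl hv
    · exact Or.inr (Or.inl hv)
    · obtain ⟨i, hi⟩ := h.exists_orient_ne_zero hxy
      refine Or.inr (Or.inr ⟨h0, i, ?_⟩)
      rw [openSegment_eq_image_lineMap] at hv
      obtain ⟨t, ⟨ht0, ht1⟩, rfl⟩ := hv
      rw [key]
      have : 0 < 1 - t := by linarith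
      positivity
  · rintro (rfl | rfl | ⟨h0, i, hi⟩)
    · exact left_mem_segment ℝ _ _
    · exact right_mem_segment ℝ _ _
    · obtain ⟨t, rfl⟩ := exists_eq_lineMap_of_orient_eq_zero hxy h0
      rw [key] at hi
      have : 0 < t * (1 - t) := pos_of_mul_pos_left hi (sq_nonneg _)
      rcases mul_pos_iff.mp this with ⟨h1, h2⟩ | ⟨h1, h2⟩
      · exact lineMap_mem_segment_of_le h1.le (by linarith)
      · linarith

end Polygon

/-! ### The formulas -/

/-- The atomic formula that the triangle on the three variables is counter-clockwise. -/
def ccwFormula {n k : ℕ} (a b c : Fin n) : MSOFormula polygonSignature n k :=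
  .rel PolygonRel.ordccw ![a, b, c]

/-- The atomic formula that there is a directed boundary edge between the two variables. -/
def edgeFormula {n k : ℕ} (a b : Fin n) : MSOFormula polygonSignature n k :=
  .rel PolygonRel.poledge ![a, b]

/-- The formula that the product of the orientations of two triangles is positive. -/
def sameOrientFormula {n k : ℕ} (a b c d e f : Fin n) : MSOFormula polygonSignature n k :=
  .or (.and (ccwFormula a b c) (ccwFormula d e f)) (.and (ccwFormula a c b) (ccwFormula d f e))

/-- The formula that the triangle on the three variables is not clockwise. -/
def notCwFormula {n k : ℕ} (a b c : Fin n) : MSOFormula polygonSignature n k :=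
  .not (ccwFormula a c b)

/-- The formula that the vertex `v` is on the segment `xy`. -/
def onSegmentFormula {n k : ℕ} (v x y : Fin n) : MSOFormula polygonSignature n k :=
  .or (.equal v x) (.or (.equal v y) (.and
    (.and (notCwFormula x y v) (notCwFormula x v y))
    (.existsElem (sameOrientFormula 0 x.succ v.succ 0 v.succ y.succ))))

/-- The formula that `p` is in the closed angle to the left of the path `a → v → b`. -/
def closedAngleFormula {n k : ℕ} (a v b p : Fin n) : MSOFormula polygonSignature n k :=
  .or (.and (notCwFormula a v b) (.and (notCwFormula a v p) (notCwFormula v b p)))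
    (.and (ccwFormula a b v) (.or (notCwFormula a v p) (notCwFormula v b p)))

/-- The formula that the segments `xy` and `zw` cross. -/
def crossFormula {n k : ℕ} (x y z w : Fin n) : MSOFormula polygonSignature n k :=
  .and (sameOrientFormula x z w y w z) (sameOrientFormula z x y w y x)

/-- The formula that the vertices `0` and `1` are adjacent in the visibility graph. -/
def visibilityFormula : MSOFormula polygonSignature 2 0 :=
  .and (.not (.equal 0 1)) (.and
    -- Inside, `2` is the vertex, `1` its predecessor, `0` its successor, and `3`, `4` are the ends
    -- of the segment.
    (.forallElem (.forallElem (.forallElem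
      (.or (.not (.and (onSegmentFormula 2 3 4) (.and (edgeFormula 1 2) (edgeFormula 2 0))))
        (.and (closedAngleFormula 1 2 0 3) (closedAngleFormula 1 2 0 4))))))
    (.forallElem (.forallElem (.or (.not (edgeFormula 1 0)) (.not (crossFormula 2 3 1 0))))))

/-! ### Semantics of the formulas -/

section Realize

variable {m : ℕ} {Q : Polygon EPlane m} {n k : ℕ} {x : Fin n → Q.vertexSet}
  {X : Fin k → Set Q.vertexSet}

theorem realize_ccwFormula {a b c : Fin n} :
    (ccwFormula a b c).Realize Q.toStructure x X ↔ 0 < orient (x a) (x b) (x c) :=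
  Iff.rfl

theorem realize_edgeFormula {a b : Fin n} :
    (edgeFormula a b).Realize Q.toStructure x X ↔
      ∃ i : Fin m, (x a : EPlane) = Q i ∧ (x b : EPlane) = Q (finRotate m i) :=
  Iff.rfl

theorem realize_sameOrientFormula {a b c d e f : Fin n} :
    (sameOrientFormula a b c d e f).Realize Q.toStructure x X ↔
      0 < orient (x a) (x b) (x c) * orient (x d) (x e) (x f) := by
  simp only [sameOrientFormula, MSOFormula.Realize, realize_ccwFormula, mul_pos_iff,
    orient_swap_right (x a : EPlane) (x b), orient_swap_right (x d : EPlane) (x e), neg_pos]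

theorem realize_notCwFormula {a b c : Fin n} :
    (notCwFormula a b c).Realize Q.toStructure x X ↔ 0 ≤ orient (x a) (x b) (x c) := by
  simp only [notCwFormula, MSOFormula.Realize, realize_ccwFormula,
    orient_swap_right (x a : EPlane) (x b), neg_pos, not_lt]

theorem realize_onSegmentFormula (h : Q.IsSimple) {v a b : Fin n} (hab : x a ≠ x b) :
    (onSegmentFormula v a b).Realize Q.toStructure x X ↔
      (x v : EPlane) ∈ segment ℝ (x a : EPlane) (x b) := by
  rw [h.mem_segment_iff fun he => hab (Subtype.ext he)]
  simp only [onSegmentFormula, MSOFormula.Realize, realize_notCwFormula,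
    realize_sameOrientFormula, Matrix.cons_val_zero, Matrix.cons_val_succ,
    orient_swap_right (x a : EPlane) (x b) (x v), Subtype.ext_iff, Subtype.exists, exists_prop,
    Set.exists_range_iff, Left.nonneg_neg_iff]
  rw [← le_antisymm_iff, eq_comm (a := (0 : ℝ))]

theorem realize_closedAngleFormula {a v b p : Fin n} :
    (closedAngleFormula a v b p).Realize Q.toStructure x X ↔
      ClosedAngle (x a) (x v) (x b) (x p) := by
  simp only [closedAngleFormula, MSOFormula.Realize, realize_notCwFormula, realize_ccwFormula,
    orient_swap_right (x a : EPlane) (x v) (x b), neg_pos, ClosedAngle]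
  split_ifs with h0
  · simp [h0, h0.not_gt]
  · simp [h0, not_le.mp h0]

theorem realize_crossFormula {a b c d : Fin n} :
    (crossFormula a b c d).Realize Q.toStructure x X ↔
      SegmentsCross (x a) (x b) (x c) (x d) := by
  simp only [crossFormula, MSOFormula.Realize, realize_sameOrientFormula, SegmentsCross,
    orient_swap_right (x b : EPlane) (x c), orient_swap_right (x d : EPlane) (x a),
    mul_neg, neg_pos]

end Realize

theorem realize_visibilityFormula {n : ℕ} {Q : Polygon EPlane n} (h : Q.IsSimple)
    (x : Fin 2 → Q.vertexSet) :
    visibilityFormula.Realize Q.toStructure x ![] ↔ x 0 ≠ x 1 ∧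
      (∀ i : Fin n, Q i ∈ segment ℝ (x 0 : EPlane) (x 1 : EPlane) →
        Q.InAngle i (x 0) ∧ Q.InAngle i (x 1)) ∧
      ∀ i : Fin n, ¬ SegmentsCross (x 0) (x 1) (Q i) (Q (finRotate n i)) := by
  simp only [visibilityFormula, MSOFormula.Realize]
  refine and_congr_right fun hne => and_congr ?_ ?_
  · constructor
    · intro H i hi
      have := H ⟨Q i, i, rfl⟩ ⟨_, (finRotate n).symm i, rfl⟩ ⟨_, finRotate n i, rfl⟩
      rw [realize_onSegmentFormula h, realize_edgeFormula, realize_edgeFormula,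
        realize_closedAngleFormula, realize_closedAngleFormula] at this
      · exact this.resolve_left (not_not.mpr ⟨hi, ⟨(finRotate n).symm i, rfl,
          by rw [Equiv.apply_symm_apply]; rfl⟩, ⟨i, rfl, rfl⟩⟩)
      · exact hne
    · intro H v a b
      rw [realize_onSegmentFormula h, realize_edgeFormula, realize_edgeFormula,
        realize_closedAngleFormula, realize_closedAngleFormula, or_iff_not_imp_left, not_not]
      · rintro ⟨h1, ⟨i, h2, h3⟩, ⟨j, h4, h5⟩⟩
        change (a : EPlane) = _ at h2
        change (v : EPlane) = _ at h3
        change (v : EPlane) = _ at h4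
        change (b : EPlane) = _ at h5
        change (v : EPlane) ∈ _ at h1
        -- By injectivity, the edge into `v` and the edge out of `v` are consecutive.
        obtain rfl : finRotate n i = j := by
          apply h.2.1; rw [← h3, ← h4]
        have := H _ (h4 ▸ h1)
        rw [Polygon.inAngle_iff, Polygon.inAngle_iff, Equiv.symm_apply_apply, ← h2, ← h4, ← h5] at this
        exact this
      · exact hne
  · constructor
    · intro H i
      have := H ⟨Q i, i, rfl⟩ ⟨_, finRotate n i, rfl⟩
      rw [realize_crossFormula, realize_edgeFormula] at this
      exact this.resolve_left (not_not.mpr ⟨i, rfl, rfl⟩)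
    · intro H z w
      rw [realize_crossFormula, realize_edgeFormula, or_iff_not_imp_left, not_not]
      rintro ⟨i, h1, h2⟩
      rw [h1, h2]
      exact H i

theorem theorem8 :
    ∃ Ψ : MSOInterpretation polygonSignature FirstOrder.Language.graph,
      ∀ (n : ℕ) (Q : Polygon EPlane n), Q.IsSimple → Q.IsCounterclockwise →
        Ψ.Interprets Q.toStructure Q.visibilityGraph.structure ∧
        ∀ x y : Q.vertexSet, x ≠ y →
          (Q.visibilityGraph.Adj x y ↔
            (∀ i : Fin n, Q i ∈ segment ℝ (x : EPlane) (y : EPlane) →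
              Q.InAngle i x ∧ Q.InAngle i y) ∧
            ∀ i : Fin n, ¬ SegmentsCross x y (Q i) (Q (finRotate n i))) := by
  refine ⟨⟨fun | .adj => visibilityFormula⟩, fun n Q h hc =>
    ⟨?_, fun x y hxy => hc.visibilityGraph_adj_iff h hxy⟩⟩
  rintro _ ⟨⟩ x
  change Q.visibilityGraph.Adj (x 0) (x 1) ↔ visibilityFormula.Realize Q.toStructure x ![]
  rw [realize_visibilityFormula h]
  by_cases hxy : x 0 = x 1
  · simp [hxy]
  · rw [hc.visibilityGraph_adj_iff h hxy]
    simp [hxy]
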